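/- Let $\mathcal H$ be a complex Hilbert space. A contraction is a bounded operator on $\mathcal H$ of norm at most $1$. A contraction $T$ is \emph{Harnack dominated} by a contraction $T'$ if there is a constant $c\ge 1$ such that $\operatorname{Re} p(T)\le c\,\operatorname{Re} p(T')$ for every polynomial $p\in\mathbb C[z]$ with $\operatorname{Re} p(z)\ge 0$ for all $|z|\le 1$, where $\operatorname{Re} A=\tfrac12(A+A^*)$. A contraction $T$ is \emph{maximal} for Harnack domination if $T$ is Harnack dominated by no contraction $T'\ne T$. For a finite positive Borel measure $\mu$ on the unit circle $\mathbb T$, let $$D_\mu(t)=\limsup_{\varepsilon\to 0^+}\frac{\mu\big(\{t e^{is}: |s|<\varepsilon\}\big)}{2\varepsilon}\in[0,\infty]\qquad (t\in\mathbb T).$$ Theorem. Let $U$ be a unitary operator on $\mathcal H$ with spectral measure $E_U$ on $\mathbb T$. (1) Let $T$ be a contraction such that $U$ is Harnack dominated by $T$, let $h\in\mathcal H$, and suppose that $y=(U-T)h\neq 0$. Then the measure $\mu_y=\langle E_U(\cdot)y,y\rangle$ satisfies $D_{\mu_y}(t)<+\infty$ for every $t\in\mathbb T$. (2) If $U$ is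 singular, i.e. for every $x\in\mathcal H$ the measure $\langle E_U(\cdot)x,x\rangle$ is singular with respect to Lebesgue measure on $\mathbb T$, then $U$ is maximal for Harnack domination. -/

import Mathlib

open MeasureTheory Filter Topology
open scoped ENNReal

/-! ### The circle as a measurable space -/

noncomputable instance Circle.instMeasurableSpaceBorel : MeasurableSpace Circle := borel Circle

instance Circle.instBorelSpaceBorel : BorelSpace Circle := ⟨rfl⟩

/-- Arc-length (Lebesgue) measure on the unit circle, of total mass `2π`. -/
noncomputable def Circle.lebesgue : Measure Circle :=
  (volume.restrict (Set.Ioc (-Real.pi) Real.pi)).map Circle.exp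

/-- The open arc of the circle centred at `t`, of half-length `ε`. -/
def Circle.arc (t : Circle) (ε : ℝ) : Set Circle :=
  (fun s : ℝ => t * Circle.exp s) '' Set.Ioo (-ε) ε

/-- Upper density of a measure on the circle:
`limsup_{ε → 0+} μ(t - ε, t + ε) / (2 ε)`, an extended nonnegative real. -/
noncomputable def Circle.upperDensity (μ : Measure Circle) (t : Circle) : ℝ≥0∞ :=
  limsup (fun ε : ℝ => μ (Circle.arc t ε) / ENNReal.ofReal (2 * ε)) (𝓝[>] 0)

/-! ### Projection-valued measures on the circle -/

/-- A projection-valued (spectral) Borel measure on the unit circle, acting on `H`: the values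
on Borel sets are orthogonal projections, the whole circle is sent to the identity, and the
measure is strongly countably additive. The values on non-Borel sets play no role. -/
structure SpectralMeasure (H : Type*) [NormedAddCommGroup H] [InnerProductSpace ℂ H]
    [CompleteSpace H] where
  proj : Set Circle → H →L[ℂ] H
  isStarProjection : ∀ S, MeasurableSet S → IsStarProjection (proj S)
  proj_univ : proj Set.univ = 1
  hasSum_iUnion : ∀ A : ℕ → Set Circle, (∀ i, MeasurableSet (A i)) →
    Pairwise (Function.onFun Disjoint A) →
    ∀ x, HasSum (fun i => proj (A i) x) (proj (⋃ i, A i) x)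

section Hilbert

variable {H : Type*} [NormedAddCommGroup H] [InnerProductSpace ℂ H] [CompleteSpace H]

theorem inner_starProjection_self {P : H →L[ℂ] H} (hP : IsStarProjection P) (x : H) :
    inner ℂ x (P x) = inner ℂ (P x) (P x) := by
  have h1 : P x = P (P x) := by
    conv_lhs => rw [← hP.isIdempotentElem.eq]
    rw [mul_apply_eq_comp]
  rw [← ContinuousLinearMap.adjoint_inner_right P x (P x),
    ← ContinuousLinearMap.star_eq_adjoint, hP.isSelfAdjoint.star_eq, ← h1]

theorem SpectralMeasure.re_inner_nonneg (E : SpectralMeasure H) {S : Set Circle}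
    (hS : MeasurableSet S) (x : H) : 0 ≤ (inner ℂ x (E.proj S x)).re := by
  rw [inner_starProjection_self (E.isStarProjection S hS)]
  exact inner_self_nonneg (𝕜 := ℂ)

/-- The scalar measure `S ↦ ⟨E(S) x, x⟩`. (Mathlib's inner product is linear in the
second variable.) -/
noncomputable def SpectralMeasure.scalarMeasure (E : SpectralMeasure H) (x : H) :
    Measure Circle :=
  Measure.ofMeasurable (fun S _ => ENNReal.ofReal (inner ℂ x (E.proj S x)).re)
    (by
      have h := E.hasSum_iUnion (fun _ => ∅) (fun _ => MeasurableSet.empty)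
        (fun _ _ _ => disjoint_bot_left) x
      have h0 : E.proj ∅ x = 0 :=
        tendsto_nhds_unique tendsto_const_nhds h.summable.tendsto_atTop_zero
      simp [h0])
    (by
      intro A hA hd
      have h := E.hasSum_iUnion A hA hd x
      have h1 : HasSum (fun i => (inner ℂ x (E.proj (A i) x)).re)
          (inner ℂ x (E.proj (⋃ i, A i) x)).re :=
        (h.mapL (innerSL ℂ x)).mapL Complex.reCLM
      rw [← h1.tsum_eq,
        ENNReal.ofReal_tsum_of_nonneg (fun i => E.re_inner_nonneg (hA i) x) h1.summable])

theorem SpectralMeasure.scalarMeasure_apply (E : SpectralMeasure H) (x : H) {S : Set Circle}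
    (hS : MeasurableSet S) :
    E.scalarMeasure x S = ENNReal.ofReal (inner ℂ x (E.proj S x)).re :=
  Measure.ofMeasurable_apply S hS

/-- `E` is the spectral measure of the unitary operator `U`: for every trigonometric monomial
`z ↦ z ^ n`, `n ∈ ℤ`, and every `x`, one has `⟨U ^ n x, x⟩ = ∫ z ^ n d⟨E(z) x, x⟩`. -/
def SpectralMeasure.IsSpectralMeasureOf (E : SpectralMeasure H) (U : unitary (H →L[ℂ] H)) :
    Prop :=
  ∀ (n : ℤ) (x : H),
    inner ℂ x (((U ^ n : unitary (H →L[ℂ] H)) : H →L[ℂ] H) x) =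
      ∫ z : Circle, ((z ^ n : Circle) : ℂ) ∂(E.scalarMeasure x)

/-! ### Every unitary operator has a spectral measure -/

namespace CircleCalculus

/-- The inclusion of the spectrum of a unitary operator into the circle. -/
noncomputable def spectrumIncl (U : unitary (H →L[ℂ] H)) :
    C(spectrum ℂ (U : H →L[ℂ] H), Circle) where
  toFun z := ⟨z.1, by
    have := Unitary.spectrum_subset_circle (𝕜 := ℂ) U z.2
    exact mem_sphere_zero_iff_norm.1 this |> fun h => by
      simpa [Submonoid.unitSphere] using h⟩
  continuous_toFun := by
    refine Continuous.subtype_mk continuous_subtype_val _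

/-- Continuous functional calculus of a unitary operator for functions on the circle. -/
noncomputable def fc (U : unitary (H →L[ℂ] H)) : C(Circle, ℂ) →⋆ₐ[ℂ] (H →L[ℂ] H) :=
  (cfcHom (R := ℂ) (p := IsStarNormal) (a := (U : H →L[ℂ] H)) inferInstance).comp
    (ContinuousMap.compStarAlgHom' ℂ ℂ (spectrumIncl U))

/-- The coordinate function on the circle. -/
noncomputable def coord : C(Circle, ℂ) := ⟨fun z => (z : ℂ), continuous_subtype_val⟩

theorem fc_coord (U : unitary (H →L[ℂ] H)) : fc U coord = (U : H →L[ℂ] H) :=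
  cfcHom_id (R := ℂ) (p := IsStarNormal) (a := (U : H →L[ℂ] H)) inferInstance

theorem fc_zpow (U : unitary (H →L[ℂ] H)) (n : ℤ) (g : C(Circle, ℂ))
    (hg : ∀ z : Circle, g z = ((z ^ n : Circle) : ℂ)) :
    fc U g = ((U ^ n : unitary (H →L[ℂ] H)) : H →L[ℂ] H) := by
  have key : ∀ m : ℕ, fc U (coord ^ m) = ((U ^ m : unitary (H →L[ℂ] H)) : H →L[ℂ] H) := by
    intro m
    rw [map_pow, fc_coord, SubmonoidClass.coe_pow]
  obtain ⟨m, rfl | rfl⟩ := n.eq_nat_or_neg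
  · have : g = coord ^ m := by
      ext z
      simp [hg, coord]
      rfl
    rw [this, key]
    simp
  · have : g = star (coord ^ m) := by
      ext z
      simp only [hg, coord, ContinuousMap.star_apply, ContinuousMap.pow_apply,
        zpow_neg, zpow_natCast, ← inv_pow, Circle.coe_pow,
        Circle.coe_inv_eq_conj, star_pow]
      rfl
    rw [this, map_star, key, zpow_neg, zpow_natCast]
    rfl

/-- Real functions as complex functions. -/
noncomputable def toC : C(Circle, ℝ) →ₐ[ℝ] C(Circle, ℂ) :=
  AlgHom.compLeftContinuous ℝ Complex.ofRealAm Complex.continuous_ofReal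

theorem toC_apply (f : C(Circle, ℝ)) (z : Circle) : toC f z = (f z : ℂ) := rfl

/-- Functional calculus for real functions on the circle. -/
noncomputable def rfc (U : unitary (H →L[ℂ] H)) : C(Circle, ℝ) →ₐ[ℝ] (H →L[ℂ] H) :=
  ((fc U).toAlgHom.restrictScalars ℝ).comp toC

theorem rfc_apply (U : unitary (H →L[ℂ] H)) (f : C(Circle, ℝ)) : rfc U f = fc U (toC f) := rfl

theorem rfc_inner (U : unitary (H →L[ℂ] H)) (f : C(Circle, ℝ)) (x y : H) :
    inner ℂ (rfc U f x) y = inner ℂ x (rfc U f y) := by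
  have h : star (rfc U f) = rfc U f := by
    rw [rfc_apply, ← map_star]
    congr 1
    ext z
    simp [toC_apply]
  conv_lhs => rw [← h, ContinuousLinearMap.star_eq_adjoint]
  rw [ContinuousLinearMap.adjoint_inner_left]

theorem rfc_inner_self (U : unitary (H →L[ℂ] H)) (f : C(Circle, ℝ)) (x : H) :
    inner ℂ x (rfc U f x) = ((inner ℂ x (rfc U f x)).re : ℂ) := by
  refine Eq.symm (Complex.conj_eq_iff_re.1 ?_)
  rw [inner_conj_symm, rfc_inner]

theorem norm_sq_rfc (U : unitary (H →L[ℂ] H)) (f : C(Circle, ℝ)) (x : H) :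
    ‖rfc U f x‖ ^ 2 = (inner ℂ x (rfc U (f * f) x)).re := by
  rw [map_mul, mul_apply_eq_comp, ← rfc_inner]
  exact (inner_self_eq_norm_sq (𝕜 := ℂ) _).symm

theorem exists_measure (U : unitary (H →L[ℂ] H)) (x : H) :
    ∃ μ : Measure Circle, IsFiniteMeasure μ ∧
      ∀ f : C(Circle, ℝ), ∫ z, f z ∂μ = (inner ℂ x (rfc U f x)).re := by
  let L : C(Circle, ℝ) →ₗ[ℝ] ℝ :=
    { toFun := fun f => (inner ℂ x (rfc U f x)).re
      map_add' := fun f g => by simp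
      map_smul' := fun r f => by
        rw [map_smul]
        simp [inner_smul_right_eq_smul] }
  have hL : ∀ f : C(Circle, ℝ), 0 ≤ f → 0 ≤ L f := by
    intro f hf
    have : f = (⟨fun z => Real.sqrt (f z), f.continuous.sqrt⟩ : C(Circle, ℝ)) *
        ⟨fun z => Real.sqrt (f z), f.continuous.sqrt⟩ := by
      ext z
      exact (Real.mul_self_sqrt (hf z)).symm
    show 0 ≤ (inner ℂ x (rfc U f x)).re
    rw [this, ← norm_sq_rfc]
    positivity
  let L' : CompactlySupportedContinuousMap Circle ℝ →ₚ[ℝ] ℝ :=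
    PositiveLinearMap.mk₀
      { toFun := fun f => L f.toContinuousMap
        map_add' := fun f g => L.map_add f.toContinuousMap g.toContinuousMap
        map_smul' := fun r f => L.map_smul r f.toContinuousMap }
      (fun f hf => hL _ (fun z => hf z))
  refine ⟨RealRMK.rieszMeasure L', inferInstance, fun f => ?_⟩
  exact RealRMK.integral_rieszMeasure L' (CompactlySupportedContinuousMap.continuousMapEquiv f)

/-- Continuous functions with values in `[0, 1]` approximate indicators in `L¹`. -/
theorem exists_approx (μ : Measure Circle) [IsFiniteMeasure μ] {S : Set Circle}
    (hS : MeasurableSet S) {ε : ℝ} (hε : 0 < ε) :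
    ∃ f : C(Circle, ℝ), (∀ z, 0 ≤ f z ∧ f z ≤ 1) ∧
      ∫ z, |S.indicator (fun _ => (1 : ℝ)) z - f z| ∂μ ≤ ε := by
  have hi : Integrable (S.indicator (fun _ => (1 : ℝ))) μ :=
    (integrable_const (1 : ℝ)).indicator hS
  obtain ⟨g, hg, hgi⟩ := hi.exists_boundedContinuous_integral_sub_le hε
  let f : C(Circle, ℝ) := ⟨fun z => max 0 (min 1 (g z)), by fun_prop⟩
  have hf : ∀ z, 0 ≤ f z ∧ f z ≤ 1 := fun z =>
    ⟨le_max_left _ _, max_le zero_le_one (min_le_left _ _)⟩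
  refine ⟨f, hf, le_trans (integral_mono_of_nonneg ?_ (hi.sub hgi).norm ?_) hg⟩
  · exact Eventually.of_forall fun z => abs_nonneg _
  · refine Eventually.of_forall fun z => ?_
    have hfz : f z = max 0 (min 1 (g z)) := rfl
    have : S.indicator (fun _ => (1 : ℝ)) z = 0 ∨ S.indicator (fun _ => (1 : ℝ)) z = 1 := by
      by_cases h : z ∈ S <;> simp [h]
    simp only [Pi.sub_apply, Real.norm_eq_abs]
    rw [hfz]
    rcases this with h | h <;> rw [h] <;>
      rcases le_total (g z) 0 with h0 | h0 <;> rcases le_total (g z) 1 with h1 | h1 <;>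
      simp only [h0, h1, max_eq_left, max_eq_right, min_eq_left, min_eq_right] <;>
      simp <;> grind

/-- The projection attached to a Borel set. -/
theorem exists_proj (U : unitary (H →L[ℂ] H)) (μ : H → Measure Circle)
    [∀ x, IsFiniteMeasure (μ x)]
    (hμ : ∀ x, ∀ f : C(Circle, ℝ), ∫ z, f z ∂(μ x) = (inner ℂ x (rfc U f x)).re)
    {S : Set Circle} (hS : MeasurableSet S) :
    ∃ P : H →L[ℂ] H, IsStarProjection P ∧ ∀ x, inner ℂ x (P x) = (((μ x).real S : ℝ) : ℂ) := by
  classical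
  have hex : ∀ i : Finset H × ℕ, ∃ f : C(Circle, ℝ), (∀ z, 0 ≤ f z ∧ f z ≤ 1) ∧
      ∀ x ∈ i.1, ∫ z, |S.indicator (fun _ => (1 : ℝ)) z - f z| ∂(μ x) ≤ 1 / ((i.2 : ℝ) + 1) := by
    intro i
    obtain ⟨f, hf, hf'⟩ := exists_approx (∑ x ∈ i.1, μ x) hS
      (show (0 : ℝ) < 1 / ((i.2 : ℝ) + 1) by positivity)
    refine ⟨f, hf, fun x hx => le_trans ?_ hf'⟩
    refine integral_mono_measure ?_ (Eventually.of_forall fun z => abs_nonneg _) ?_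
    · exact Finset.single_le_sum (f := fun x => μ x) (fun _ _ => Measure.zero_le _) hx
    · exact (((integrable_const (1 : ℝ)).indicator hS).sub
        (f.continuous.integrable_of_hasCompactSupport (HasCompactSupport.of_compactSpace _))).abs
  choose g hg01 hg using hex
  have hint : ∀ (f : C(Circle, ℝ)) (x : H), Integrable (fun z => f z) (μ x) := fun f x =>
    f.continuous.integrable_of_hasCompactSupport (HasCompactSupport.of_compactSpace _)
  have hind : ∀ x : H, Integrable (S.indicator (fun _ => (1 : ℝ))) (μ x) := fun x =>
    (integrable_const (1 : ℝ)).indicator hS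
  -- the error tends to zero
  have herr : ∀ x, Tendsto (fun i => ∫ z, |S.indicator (fun _ => (1 : ℝ)) z - g i z| ∂(μ x))
      atTop (𝓝 0) := by
    intro x
    have h1 : Tendsto (fun i : Finset H × ℕ => 1 / ((i.2 : ℝ) + 1)) atTop (𝓝 0) := by
      have : Tendsto (fun i : Finset H × ℕ => i.2) atTop atTop := by
        rw [← prod_atTop_atTop_eq]
        exact tendsto_snd
      exact tendsto_one_div_add_atTop_nhds_zero_nat.comp this
    refine squeeze_zero' (Eventually.of_forall fun i =>
      integral_nonneg fun z => abs_nonneg _) ?_ h1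
    filter_upwards [eventually_ge_atTop (({x}, 0) : Finset H × ℕ)] with i hi
    exact hg i x (hi.1 (Finset.mem_singleton_self x))
  have hnorm : ∀ (f : C(Circle, ℝ)) (x : H), ‖rfc U f x‖ ^ 2 = ∫ z, f z * f z ∂(μ x) := by
    intro f x
    rw [norm_sq_rfc, ← hμ]
    rfl
  -- convergence
  have hcauchy : ∀ x, ∃ y, Tendsto (fun i => rfc U (g i) x) atTop (𝓝 y) := by
    intro x
    refine cauchy_map_iff_exists_tendsto.1 (Metric.cauchy_iff.2 ⟨inferInstance, fun ε hε => ?_⟩)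
    have hε2 : 0 < ε ^ 2 / 4 := by positivity
    have hev := (herr x).eventually (gt_mem_nhds hε2)
    refine ⟨_, image_mem_map hev, ?_⟩
    rintro _ ⟨i, hi, rfl⟩ _ ⟨j, hj, rfl⟩
    simp only [Set.mem_ofPred_eq] at hi hj
    rw [dist_eq_norm, ← sub_apply, ← map_sub]
    refine lt_of_pow_lt_pow_left₀ 2 hε.le ?_
    rw [hnorm]
    have h1 : ∫ z, (g i - g j) z * (g i - g j) z ∂(μ x) ≤
        ∫ z, (|S.indicator (fun _ => (1 : ℝ)) z - g i z| +
          |S.indicator (fun _ => (1 : ℝ)) z - g j z|) ∂(μ x) := by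
      refine integral_mono (hint ((g i - g j) * (g i - g j)) x)
        (((hind x).sub (hint (g i) x)).abs.add ((hind x).sub (hint (g j) x)).abs) fun z => ?_
      obtain ⟨ha, ha'⟩ := hg01 i z
      obtain ⟨hb, hb'⟩ := hg01 j z
      have h3 : |g i z - g j z| ≤ 1 := abs_le.2 ⟨by linarith, by linarith⟩
      have h4 : |g i z - g j z| ≤ |S.indicator (fun _ => (1 : ℝ)) z - g i z| +
          |S.indicator (fun _ => (1 : ℝ)) z - g j z| := by
        rw [abs_sub_comm (S.indicator (fun _ => (1 : ℝ)) z) (g i z)]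
        exact abs_sub_le _ _ _
      have h5 : (g i z - g j z) * (g i z - g j z) = |g i z - g j z| * |g i z - g j z| :=
        (abs_mul_abs_self _).symm
      simp only [ContinuousMap.sub_apply]
      rw [h5]
      nlinarith [abs_nonneg (g i z - g j z)]
    have h6 : ∫ z, (|S.indicator (fun _ => (1 : ℝ)) z - g i z| +
        |S.indicator (fun _ => (1 : ℝ)) z - g j z|) ∂(μ x) =
        ∫ z, |S.indicator (fun _ => (1 : ℝ)) z - g i z| ∂(μ x) +
          ∫ z, |S.indicator (fun _ => (1 : ℝ)) z - g j z| ∂(μ x) :=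
      integral_add ((hind x).sub (hint (g i) x)).abs ((hind x).sub (hint (g j) x)).abs
    rw [h6] at h1
    nlinarith
  choose Q hQ using hcauchy
  have hQnorm : ∀ x, ‖Q x‖ ≤ 1 * ‖x‖ := by
    intro x
    rw [one_mul]
    refine le_of_tendsto (hQ x).norm (Eventually.of_forall fun i => ?_)
    refine le_of_sq_le_sq ?_ (norm_nonneg _)
    have h1 : ‖x‖ ^ 2 = ∫ z, (1 : C(Circle, ℝ)) z * (1 : C(Circle, ℝ)) z ∂(μ x) := by
      rw [← hnorm, map_one]; rfl
    rw [hnorm, h1]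
    refine integral_mono (hint (g i * g i) x) (hint (1 * 1) x) fun z => ?_
    obtain ⟨ha, ha'⟩ := hg01 i z
    simp only [ContinuousMap.one_apply]
    nlinarith
  let P : H →L[ℂ] H := LinearMap.mkContinuous
    { toFun := Q
      map_add' := fun x y => by
        refine tendsto_nhds_unique (hQ (x + y)) ?_
        simpa only [map_add] using (hQ x).add (hQ y)
      map_smul' := fun c x => by
        refine tendsto_nhds_unique (hQ (c • x)) ?_
        simpa only [map_smul, RingHom.id_apply] using (hQ x).const_smul c } 1 hQnorm
  have hP : ∀ x, Tendsto (fun i => rfc U (g i) x) atTop (𝓝 (P x)) := hQ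
  have hsa : ∀ x y, inner ℂ (P x) y = inner ℂ x (P y) := by
    intro x y
    refine tendsto_nhds_unique ((hP x).inner tendsto_const_nhds) ?_
    simpa only [rfc_inner] using (tendsto_const_nhds (x := x)).inner (𝕜 := ℂ) (hP y)
  have hid : ∀ x, Tendsto (fun i => rfc U (g i * g i) x) atTop (𝓝 (P x)) := by
    intro x
    have h0 : Tendsto (fun i => rfc U (g i * g i - g i) x) atTop (𝓝 0) := by
      rw [tendsto_zero_iff_norm_tendsto_zero]
      have h2 : Tendsto (fun i => ‖rfc U (g i * g i - g i) x‖ ^ 2) atTop (𝓝 0) := by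
        refine squeeze_zero (fun i => by positivity) (fun i => ?_) (herr x)
        rw [hnorm]
        refine integral_mono (hint ((g i * g i - g i) * (g i * g i - g i)) x)
          ((hind x).sub (hint (g i) x)).abs fun z => ?_
        obtain ⟨ha, ha'⟩ := hg01 i z
        simp only [ContinuousMap.sub_apply, ContinuousMap.mul_apply]
        have h5 : (g i z * g i z - g i z) * (g i z * g i z - g i z) ≤ g i z * (1 - g i z) := by
          nlinarith [mul_nonneg ha (sub_nonneg.2 ha'), mul_nonneg (mul_nonneg ha (sub_nonneg.2 ha')) ha]
        refine h5.trans ?_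
        by_cases h : z ∈ S
        · simp only [h, Set.indicator_of_mem]
          rw [abs_of_nonneg (by linarith)]
          nlinarith
        · simp only [h, not_false_eq_true, Set.indicator_of_notMem]
          rw [zero_sub, abs_neg, abs_of_nonneg ha]
          nlinarith
      have := h2.sqrt
      simpa [Real.sqrt_sq] using this
    have := h0.add (hP x)
    simpa only [map_sub, sub_apply, sub_add_cancel, zero_add] using this
  refine ⟨P, ⟨?_, ?_⟩, fun x => ?_⟩
  · ext x
    refine ext_inner_left ℂ fun y => ?_
    rw [mul_apply_eq_comp, ← hsa]
    refine tendsto_nhds_unique ((hP y).inner (hP x)) ?_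
    have := (tendsto_const_nhds (x := y)).inner (𝕜 := ℂ) (hid x)
    simpa only [map_mul, mul_apply_eq_comp, rfc_inner] using this
  · rw [IsSelfAdjoint, ContinuousLinearMap.star_eq_adjoint]
    ext x
    refine ext_inner_left ℂ fun y => ?_
    rw [ContinuousLinearMap.adjoint_inner_right, hsa]
  · have h1 : Tendsto (fun i => ∫ z, g i z ∂(μ x)) atTop (𝓝 ((μ x).real S)) := by
      rw [tendsto_iff_norm_sub_tendsto_zero]
      refine squeeze_zero (fun i => norm_nonneg _) (fun i => ?_) (herr x)
      have h2 : (μ x).real S = ∫ z, S.indicator (fun _ => (1 : ℝ)) z ∂(μ x) := by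
        rw [integral_indicator_const _ hS]; simp
      rw [h2, norm_sub_rev, ← integral_sub (hind x) (hint (g i) x)]
      exact norm_integral_le_integral_norm _
    refine tendsto_nhds_unique ((tendsto_const_nhds (x := x)).inner (𝕜 := ℂ) (hP x)) ?_
    have h3 := (Complex.continuous_ofReal.tendsto _).comp h1
    refine h3.congr fun i => ?_
    simp only [Function.comp_apply]
    rw [hμ, ← rfc_inner_self]

end CircleCalculus

open CircleCalculus in
/-- **Spectral theorem** for unitary operators: a spectral measure exists. -/
theorem SpectralMeasure.exists_isSpectralMeasureOf (U : unitary (H →L[ℂ] H)) :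
    ∃ E : SpectralMeasure H, E.IsSpectralMeasureOf U := by
  classical
  choose μ hfin hμ using exists_measure U
  have hex : ∀ S : Set Circle, ∃ P : H →L[ℂ] H, MeasurableSet S →
      IsStarProjection P ∧ ∀ x, inner ℂ x (P x) = (((μ x).real S : ℝ) : ℂ) := by
    intro S
    by_cases hS : MeasurableSet S
    · obtain ⟨P, hP⟩ := exists_proj U μ hμ hS
      exact ⟨P, fun _ => hP⟩
    · exact ⟨0, fun h => absurd h hS⟩
  choose P hP using hex
  have hq : ∀ S, MeasurableSet S → ∀ x, inner ℂ x (P S x) = (((μ x).real S : ℝ) : ℂ) :=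
    fun S hS => (hP S hS).2
  have hext : ∀ A B : H →L[ℂ] H, (∀ x, inner ℂ x (A x) = inner ℂ x (B x)) → A = B := by
    intro A B h
    have h' : (A : H →ₗ[ℂ] H) = (B : H →ₗ[ℂ] H) := by
      rw [← ext_inner_map]
      intro x
      rw [← inner_conj_symm, ← inner_conj_symm (B.toLinearMap x)]
      exact congrArg _ (h x)
    exact ContinuousLinearMap.coe_injective h'
  have hn : ∀ S, MeasurableSet S → ∀ x, ‖P S x‖ ^ 2 = (μ x).real S := by
    intro S hS x
    have h1 := inner_starProjection_self (hP S hS).1 x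
    rw [hq S hS, inner_self_eq_norm_sq_to_K] at h1
    have h2 : (((μ x).real S : ℝ) : ℂ) = ((‖P S x‖ ^ 2 : ℝ) : ℂ) := by
      rw [h1]
      norm_cast
    exact (Complex.ofReal_injective h2).symm
  have hadd : ∀ S T, MeasurableSet S → MeasurableSet T → Disjoint S T →
      P (S ∪ T) = P S + P T := by
    intro S T hS hT hd
    refine hext _ _ fun x => ?_
    rw [hq _ (hS.union hT), add_apply, inner_add_right, hq S hS, hq T hT,
      measureReal_union hd hT]
    push_cast
    rfl
  have hempty : P ∅ = 0 := by
    refine hext _ _ fun x => ?_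
    rw [hq _ MeasurableSet.empty]
    simp
  have huniv : P Set.univ = 1 := by
    refine hext _ _ fun x => ?_
    have h := hμ x 1
    rw [map_one] at h
    have h2 : inner ℂ x ((1 : H →L[ℂ] H) x) = ((‖x‖ ^ 2 : ℝ) : ℂ) := by
      rw [one_apply_eq_self, inner_self_eq_norm_sq_to_K]
      norm_cast
    rw [hq _ MeasurableSet.univ, h2]
    rw [h2] at h
    simp only [ContinuousMap.one_apply, integral_const, smul_eq_mul, mul_one,
      Complex.ofReal_re] at h
    rw [h]
  let E : SpectralMeasure H :=
    { proj := P
      isStarProjection := fun S hS => (hP S hS).1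
      proj_univ := huniv
      hasSum_iUnion := by
        intro A hA hd x
        have hfinset : ∀ s : Finset ℕ, P (⋃ i, A i) =
            P ((⋃ i, A i) \ ⋃ i ∈ s, A i) + ∑ i ∈ s, P (A i) := by
          intro s
          have h1 : ∀ s : Finset ℕ, P (⋃ i ∈ s, A i) = ∑ i ∈ s, P (A i) := by
            intro s
            induction s using Finset.induction_on with
            | empty => simpa using hempty
            | insert a s ha ih =>
              rw [Finset.set_biUnion_insert, hadd _ _ (hA a)
                (s.measurableSet_biUnion fun i _ => hA i) ?_, ih, Finset.sum_insert ha]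
              rw [Set.disjoint_iUnion₂_right]
              intro i hi
              exact hd fun h => ha (h ▸ hi)
          rw [← h1, ← hadd]
          · congr 1
            exact (Set.sdiff_union_of_subset (Set.iUnion₂_subset fun i _ =>
              Set.subset_iUnion A i)).symm
          · exact (MeasurableSet.iUnion hA).diff (s.measurableSet_biUnion fun i _ => hA i)
          · exact s.measurableSet_biUnion fun i _ => hA i
          · exact Set.disjoint_sdiff_left
        have hs : HasSum (fun i => (μ x).real (A i)) ((μ x).real (⋃ i, A i)) := by
          have h1 := measure_iUnion (μ := μ x) hd hA
          have h2 : ∑' i, μ x (A i) ≠ ⊤ := h1 ▸ measure_ne_top _ _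
          have h3 := (ENNReal.summable_toReal h2).hasSum
          rwa [← ENNReal.tsum_toReal_eq fun i => measure_ne_top _ _, ← h1] at h3
        rw [HasSum, tendsto_iff_norm_sub_tendsto_zero]
        have h2 : ∀ s : Finset ℕ, ‖∑ i ∈ s, P (A i) x - P (⋃ i, A i) x‖ ^ 2 =
            (μ x).real (⋃ i, A i) - ∑ i ∈ s, (μ x).real (A i) := by
          intro s
          have hm := (MeasurableSet.iUnion hA).diff (s.measurableSet_biUnion fun i _ => hA i)
          have h3 := congrArg (fun B : H →L[ℂ] H => B x) (hfinset s)
          simp only [add_apply, sum_apply] at h3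
          rw [h3, sub_add_cancel_right, norm_neg, hn _ hm, measureReal_sdiff
            (Set.iUnion₂_subset fun i _ => Set.subset_iUnion A i)
            (s.measurableSet_biUnion fun i _ => hA i),
            measureReal_biUnion_finset (fun i _ j _ hij => hd hij) fun i _ => hA i]
        have h4 : Tendsto (fun s : Finset ℕ => ‖∑ i ∈ s, P (A i) x - P (⋃ i, A i) x‖ ^ 2)
            atTop (𝓝 0) := by
          simp only [h2]
          simpa using (tendsto_const_nhds (x := (μ x).real (⋃ i, A i))).sub hs
        simpa [Real.sqrt_sq] using h4.sqrt }
  have hE : ∀ x, E.scalarMeasure x = μ x := by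
    intro x
    ext S hS
    rw [E.scalarMeasure_apply x hS]
    show ENNReal.ofReal (inner ℂ x (P S x)).re = _
    rw [hq S hS, Complex.ofReal_re, ofReal_measureReal]
  refine ⟨E, fun n x => ?_⟩
  rw [hE]
  let a : C(Circle, ℂ) := ⟨fun z => ((z ^ n : Circle) : ℂ),
    continuous_subtype_val.comp (continuous_zpow n)⟩
  let ar : C(Circle, ℝ) := ⟨fun z => (a z).re, by fun_prop⟩
  let ai : C(Circle, ℝ) := ⟨fun z => (a z).im, by fun_prop⟩
  have ha : a = toC ar + Complex.I • toC ai := by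
    ext z
    simp only [ContinuousMap.add_apply, ContinuousMap.smul_apply, toC_apply, smul_eq_mul]
    rw [mul_comm]
    exact (Complex.re_add_im (a z)).symm
  have hint : Integrable (fun z => a z) (μ x) :=
    a.continuous.integrable_of_hasCompactSupport (HasCompactSupport.of_compactSpace _)
  rw [← fc_zpow U n a fun z => rfl, ha, map_add, map_smul, ← rfc_apply, ← rfc_apply, add_apply,
    smul_apply, inner_add_right, inner_smul_right, rfc_inner_self, rfc_inner_self U ai, ← hμ,
    ← hμ, mul_comm]
  exact (integral_re_add_im hint)

/-- The spectral measure `E_U` of a unitary operator `U`. -/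
noncomputable def spectralMeasure (U : unitary (H →L[ℂ] H)) : SpectralMeasure H :=
  (SpectralMeasure.exists_isSpectralMeasureOf U).choose

theorem spectralMeasure_spec (U : unitary (H →L[ℂ] H)) :
    (spectralMeasure U).IsSpectralMeasureOf U :=
  (SpectralMeasure.exists_isSpectralMeasureOf U).choose_spec

/-- A unitary operator is singular if its spectral measure is singular with respect to Lebesgue
measure on the circle, i.e. all the scalar measures `⟨E_U x, x⟩` are. -/
def IsSingularUnitary (U : unitary (H →L[ℂ] H)) : Prop :=
  ∀ x : H, (spectralMeasure U).scalarMeasure x ⟂ₘ Circle.lebesgue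

/-! ### Harnack domination -/

/-- `T` is Harnack dominated by `T'`: there is a constant `c ≥ 1` such that
`Re p(T) ≤ c Re p(T')` for every polynomial `p` with `Re p ≥ 0` on the closed unit disc.
Here `realPart A = (A + A*) / 2`, and operators carry the Loewner order. -/
def HarnackDominated (T T' : H →L[ℂ] H) : Prop :=
  ∃ c : ℝ, 1 ≤ c ∧ ∀ p : Polynomial ℂ, (∀ z : ℂ, ‖z‖ ≤ 1 → 0 ≤ (p.eval z).re) →
    (realPart (Polynomial.aeval T p) : H →L[ℂ] H) ≤
      c • (realPart (Polynomial.aeval T' p) : H →L[ℂ] H)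

/-- A contraction `T` is maximal for Harnack domination if it is Harnack dominated by no
contraction other than itself. -/
def IsHarnackMaximal (T : H →L[ℂ] H) : Prop :=
  ‖T‖ ≤ 1 ∧ ∀ T' : H →L[ℂ] H, ‖T'‖ ≤ 1 → HarnackDominated T T' → T' = T

end Hilbert

/-! Put `y = (U - T) h`. Everything follows from one estimate: the mass that the scalar measure of
`y` gives to an arc of half-length `ε` is at most `K * ε`, with `K` independent of the centre.

Harnack domination, tested on truncated Herglotz kernels, passes to the limit `Re (1 + aU)(1 - aU)⁻¹
≤ c Re (1 + aT)(1 - aT)⁻¹` for `‖a‖ < 1`. For a contraction `S`, the quadratic form of this real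
part at `(1 - aS) g` is `‖g‖² - ‖a S g‖²`. Evaluate both sides at `(1 - aT) h = (1 - aU)(h + a k)`,
where `k = (1 - aU)⁻¹ y`. The right side is at most `c ‖h‖²`, and the left side is `(1 - ‖a‖²) ‖h +
a k‖²` because `U` is isometric. So `‖k‖²` is `O(1 / ε)` when `‖a‖ = 1 - ε`
(`HarnackDominated.exists_norm_sq_resolvent_le`).

On the other hand `‖k‖²` is the integral of `‖1 - a z‖⁻²` against the measure of `y`. For `a = (1 -
ε) t⁻¹` the integrand is at least `1 / (4 ε²)` on the arc around `t`, so the arc has mass at most `4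
ε² ‖k‖² = O(ε)` (`HarnackDominated.exists_scalarMeasure_arc_le`).

This bounds the upper density at every point. Being uniform in `t`, it also makes the measure
absolutely continuous; if `U` is singular the measure vanishes, hence `y = 0` for every `h`, that is
`T = U`. -/

/-! ### Truncated Herglotz kernels as test polynomials -/

theorem Complex.re_two_mul_inv_one_sub_sub_one {u : ℂ} (hu : u ≠ 1) :
    (2 * (1 - u)⁻¹ - 1).re = (1 - ‖u‖ ^ 2) / ‖1 - u‖ ^ 2 := by
  have h : ‖1 - u‖ ^ 2 ≠ 0 := by
    simpa [sub_eq_zero] using hu.symm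
  rw [← Complex.normSq_eq_norm_sq] at h ⊢
  rw [← Complex.normSq_eq_norm_sq]
  have h2 : (2 * (1 - u)⁻¹ - 1).re = 2 * ((1 - u.re) / Complex.normSq (1 - u)) - 1 := by
    simp [Complex.inv_re]
  rw [h2]
  field_simp
  simp only [Complex.normSq_apply, Complex.sub_re, Complex.sub_im, Complex.one_re, Complex.one_im]
  ring

/-- Truncations of the Herglotz kernel `2 (1 - a z)⁻¹ - 1`, shifted by a constant so that their
real part is nonnegative on the closed unit disc. -/
noncomputable def herglotzPolynomial (a : ℂ) (N : ℕ) : Polynomial ℂ :=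
  2 * ∑ n ∈ Finset.range N, (Polynomial.C a * Polynomial.X) ^ n - 1 +
    Polynomial.C ((2 * (‖a‖ ^ N / (1 - ‖a‖)) : ℝ) : ℂ)

/-- With `u = a z`, the full kernel has nonnegative real part (a Poisson kernel), and the discarded
tail `2 u ^ N / (1 - u)` is no larger in norm than the constant added in the definition. -/
theorem herglotzPolynomial_re_nonneg {a : ℂ} (ha : ‖a‖ < 1) (N : ℕ) {z : ℂ} (hz : ‖z‖ ≤ 1) :
    0 ≤ ((herglotzPolynomial a N).eval z).re := by
  set u := a * z with hu
  have hur : ‖u‖ ≤ ‖a‖ := by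
    rw [hu, norm_mul]
    exact mul_le_of_le_one_right (norm_nonneg _) hz
  have hu1 : u ≠ 1 := by
    rintro h
    rw [h, norm_one] at hur
    linarith
  have hd : 1 - ‖a‖ ≤ ‖1 - u‖ := by
    have := norm_sub_norm_le (1 : ℂ) u
    rw [norm_one] at this
    linarith
  have hgeom : ∑ n ∈ Finset.range N, u ^ n = (1 - u)⁻¹ - u ^ N * (1 - u)⁻¹ := by
    rw [geom_sum_eq hu1]
    have : 1 - u ≠ 0 := sub_ne_zero.2 hu1.symm
    have : u - 1 ≠ 0 := sub_ne_zero.2 hu1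
    field_simp
    ring
  have heval : (herglotzPolynomial a N).eval z =
      (2 * (1 - u)⁻¹ - 1) - 2 * (u ^ N * (1 - u)⁻¹) +
        ((2 * (‖a‖ ^ N / (1 - ‖a‖)) : ℝ) : ℂ) := by
    simp only [herglotzPolynomial, Polynomial.eval_add, Polynomial.eval_sub, Polynomial.eval_mul,
      Polynomial.eval_finsetSum, Polynomial.eval_pow, Polynomial.eval_C, Polynomial.eval_X,
      Polynomial.eval_ofNat, Polynomial.eval_one, ← hu, hgeom]
    ring
  have h1 : 0 ≤ (2 * (1 - u)⁻¹ - 1).re := by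
    rw [Complex.re_two_mul_inv_one_sub_sub_one hu1]
    have : ‖u‖ ^ 2 ≤ 1 := pow_le_one₀ (norm_nonneg _) (by linarith)
    exact div_nonneg (by linarith) (by positivity)
  have h2 : (2 * (u ^ N * (1 - u)⁻¹)).re ≤ 2 * (‖a‖ ^ N / (1 - ‖a‖)) := by
    refine (Complex.re_le_norm _).trans ?_
    rw [norm_mul, norm_mul, norm_pow, norm_inv, ← div_eq_mul_inv, Complex.norm_ofNat]
    have h0 : 0 < 1 - ‖a‖ := by linarith
    gcongr
  rw [heval, Complex.add_re, Complex.sub_re, Complex.ofReal_re]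
  linarith

theorem aeval_herglotzPolynomial {H : Type*} [NormedAddCommGroup H] [InnerProductSpace ℂ H]
    (a : ℂ) (N : ℕ) (T : H →L[ℂ] H) :
    Polynomial.aeval T (herglotzPolynomial a N) =
      2 * ∑ n ∈ Finset.range N, (a • T) ^ n - 1 +
        ((2 * (‖a‖ ^ N / (1 - ‖a‖)) : ℝ) : ℂ) • (1 : H →L[ℂ] H) := by
  simp only [herglotzPolynomial, map_add, map_sub, map_mul, map_sum, map_pow, map_one,
    Polynomial.aeval_C, Polynomial.aeval_X, map_ofNat, Algebra.algebraMap_eq_smul_one,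
    smul_mul_assoc, one_mul]

/-! ### The operator Herglotz kernel and the resolvent estimate -/

section Hilbert

variable {H : Type*} [NormedAddCommGroup H] [InnerProductSpace ℂ H] [CompleteSpace H]

theorem norm_smul_lt_one {a : ℂ} (ha : ‖a‖ < 1) {T : H →L[ℂ] H} (hT : ‖T‖ ≤ 1) :
    ‖a • T‖ < 1 := by
  rw [norm_smul]
  exact (mul_le_of_le_one_right (norm_nonneg _) hT).trans_lt ha

/-- The Neumann series converges in norm and the correcting constant decays like `‖a‖ ^ N`. The
limit is `(1 + aT)(1 - aT)⁻¹`, written with `∑'` in place of the inverse. -/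
theorem tendsto_aeval_herglotzPolynomial {a : ℂ} (ha : ‖a‖ < 1) {T : H →L[ℂ] H} (hT : ‖T‖ ≤ 1) :
    Tendsto (fun N => Polynomial.aeval T (herglotzPolynomial a N)) atTop
      (𝓝 (2 * ∑' n, (a • T) ^ n - 1)) := by
  simp only [aeval_herglotzPolynomial]
  have h1 := (summable_geometric_of_norm_lt_one (norm_smul_lt_one ha hT)).hasSum.tendsto_sum_nat
  have h2 : Tendsto (fun N => ((2 * (‖a‖ ^ N / (1 - ‖a‖)) : ℝ) : ℂ)) atTop (𝓝 0) := by
    have h3 := ((tendsto_pow_atTop_nhds_zero_of_lt_one (norm_nonneg a) ha).div_const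
      (1 - ‖a‖)).const_mul 2
    rw [zero_div, mul_zero] at h3
    exact_mod_cast (Complex.continuous_ofReal.tendsto 0).comp h3
  simpa using ((h1.const_mul 2).sub_const 1).add (h2.smul_const (1 : H →L[ℂ] H))

theorem re_inner_realPart (A : H →L[ℂ] H) (x : H) :
    (inner ℂ x ((realPart A : H →L[ℂ] H) x)).re = (inner ℂ x (A x)).re := by
  have h : (inner ℂ x (star A x)).re = (inner ℂ x (A x)).re := by
    rw [ContinuousLinearMap.star_eq_adjoint, ContinuousLinearMap.adjoint_inner_right,
      ← inner_conj_symm, Complex.conj_re]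
  rw [realPart_apply_coe, smul_apply, add_apply, inner_smul_right_eq_smul, inner_add_right,
    Complex.smul_re, Complex.add_re, h, smul_eq_mul]
  ring

theorem re_inner_le_of_realPart_le {A B : H →L[ℂ] H} {c : ℝ}
    (h : (realPart A : H →L[ℂ] H) ≤ c • (realPart B : H →L[ℂ] H)) (x : H) :
    (inner ℂ x (A x)).re ≤ c * (inner ℂ x (B x)).re := by
  have h1 := ((ContinuousLinearMap.le_def _ _).1 h).re_inner_nonneg_right x
  rw [sub_apply, smul_apply, inner_sub_right, inner_smul_right_eq_smul] at h1
  simp only [map_sub, RCLike.re_to_complex, Complex.smul_re, re_inner_realPart,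
    smul_eq_mul] at h1
  linarith

theorem HarnackDominated.exists_re_inner_le {T T' : H →L[ℂ] H} (h : HarnackDominated T T')
    (hT : ‖T‖ ≤ 1) (hT' : ‖T'‖ ≤ 1) :
    ∃ c : ℝ, 1 ≤ c ∧ ∀ (a : ℂ), ‖a‖ < 1 → ∀ x,
      (inner ℂ x ((2 * ∑' n, (a • T) ^ n - 1 : H →L[ℂ] H) x)).re ≤
        c * (inner ℂ x ((2 * ∑' n, (a • T') ^ n - 1 : H →L[ℂ] H) x)).re := by
  obtain ⟨c, hc, h⟩ := h
  refine ⟨c, hc, fun a ha x => ?_⟩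
  have hlim : ∀ S : H →L[ℂ] H, ‖S‖ ≤ 1 → Tendsto (fun N =>
      (inner ℂ x (Polynomial.aeval S (herglotzPolynomial a N) x)).re) atTop
      (𝓝 (inner ℂ x ((2 * ∑' n, (a • S) ^ n - 1 : H →L[ℂ] H) x)).re) := by
    intro S hS
    have hcont : Continuous fun A : H →L[ℂ] H => (inner ℂ x (A x)).re := by fun_prop
    exact (hcont.tendsto _).comp (tendsto_aeval_herglotzPolynomial ha hS)
  exact le_of_tendsto_of_tendsto' (hlim T hT) ((hlim T' hT').const_mul c) fun N =>
    re_inner_le_of_realPart_le (h _ fun z hz => herglotzPolynomial_re_nonneg ha N hz) x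

theorem tsum_pow_apply_sub {S : H →L[ℂ] H} (hS : ‖S‖ < 1) (g : H) :
    (∑' n, S ^ n) (g - S g) = g := by
  have h := congrArg (fun A : H →L[ℂ] H => A g) (geom_series_mul_neg S hS)
  simpa [mul_apply_eq_comp] using h

theorem tsum_pow_sub_apply {S : H →L[ℂ] H} (hS : ‖S‖ < 1) (y : H) :
    (∑' n, S ^ n) y - S ((∑' n, S ^ n) y) = y := by
  have h := congrArg (fun A : H →L[ℂ] H => A y) (mul_neg_geom_series S hS)
  simpa only [mul_apply_eq_comp, sub_apply, one_apply_eq_self] using h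

/-- The operator `(1 + S)(1 - S)⁻¹` sends `(1 - S) g` to `(1 + S) g`, and in `Re ⟪g - S g, g + S g⟫`
the cross terms cancel. -/
theorem re_inner_herglotz {S : H →L[ℂ] H} (hS : ‖S‖ < 1) (g : H) :
    (inner ℂ (g - S g) ((2 * ∑' n, S ^ n - 1 : H →L[ℂ] H) (g - S g))).re =
      ‖g‖ ^ 2 - ‖S g‖ ^ 2 := by
  have h1 : (2 * ∑' n, S ^ n - 1 : H →L[ℂ] H) (g - S g) = g + S g := by
    rw [two_mul, sub_apply, add_apply, tsum_pow_apply_sub hS, one_apply_eq_self]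
    abel
  have h2 : (inner ℂ (S g) g).re = (inner ℂ g (S g)).re := by
    rw [← inner_conj_symm, Complex.conj_re]
  have h3 : ∀ v : H, (inner ℂ v v).re = ‖v‖ ^ 2 := fun v => inner_self_eq_norm_sq (𝕜 := ℂ) v
  rw [h1, inner_sub_left, inner_add_right, inner_add_right, Complex.sub_re, Complex.add_re,
    Complex.add_re, h2, h3, h3]
  ring

theorem norm_unitary_coe_le_one (U : unitary (H →L[ℂ] H)) : ‖(U : H →L[ℂ] H)‖ ≤ 1 :=
  ContinuousLinearMap.opNorm_le_bound _ zero_le_one fun x => by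
    rw [one_mul, ContinuousLinearMap.norm_map_of_mem_unitary U.2]

theorem re_inner_herglotz_unitary (U : unitary (H →L[ℂ] H)) {a : ℂ} (ha : ‖a‖ < 1) (g : H) :
    (inner ℂ (g - (a • (U : H →L[ℂ] H)) g) ((2 * ∑' n, (a • (U : H →L[ℂ] H)) ^ n - 1 : H →L[ℂ] H)
      (g - (a • (U : H →L[ℂ] H)) g))).re = (1 - ‖a‖ ^ 2) * ‖g‖ ^ 2 := by
  rw [re_inner_herglotz (norm_smul_lt_one ha (norm_unitary_coe_le_one U)), smul_apply, norm_smul,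
    ContinuousLinearMap.norm_map_of_mem_unitary U.2]
  ring

/-- The resolvent of `U` at `(U - T) h` is controlled by `h` when `U` is Harnack dominated
by `T`. -/
theorem HarnackDominated.exists_norm_sq_resolvent_le {U : unitary (H →L[ℂ] H)} {T : H →L[ℂ] H}
    (hT : ‖T‖ ≤ 1) (hUT : HarnackDominated (U : H →L[ℂ] H) T) :
    ∃ c : ℝ, 1 ≤ c ∧ ∀ (a : ℂ), ‖a‖ < 1 → ∀ h : H,
      (1 - ‖a‖ ^ 2) * ‖h + a • (∑' n, (a • (U : H →L[ℂ] H)) ^ n) ((U : H →L[ℂ] H) h - T h)‖ ^ 2 ≤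
        c * ‖h‖ ^ 2 := by
  obtain ⟨c, hc, hle⟩ := hUT.exists_re_inner_le (norm_unitary_coe_le_one U) hT
  refine ⟨c, hc, fun a ha h => ?_⟩
  set V := a • (U : H →L[ℂ] H) with hV
  have hV1 : ‖V‖ < 1 := norm_smul_lt_one ha (norm_unitary_coe_le_one U)
  set k := (∑' n, V ^ n) ((U : H →L[ℂ] H) h - T h) with hk
  have hkV : k - V k = (U : H →L[ℂ] H) h - T h := tsum_pow_sub_apply hV1 _
  -- The test vector must lie in both forms: `(1 - aT) h = (1 - aU) h + a (U - T) h`, and the last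
  -- term is `a (1 - aU) k`.
  have hx : h + a • k - V (h + a • k) = h - (a • T) h := by
    have : h + a • k - V (h + a • k) = h - V h + a • (k - V k) := by
      rw [map_add, map_smul, smul_sub]
      abel
    rw [this, hkV, hV, smul_apply, smul_apply, smul_sub]
    abel
  have h1 := hle a ha (h - (a • T) h)
  rw [re_inner_herglotz (norm_smul_lt_one ha hT), ← hx,
    re_inner_herglotz_unitary U ha] at h1
  refine h1.trans (mul_le_mul_of_nonneg_left ?_ (by linarith))
  linarith [sq_nonneg ‖(a • T) h‖]

/-! ### The resolvent in terms of the spectral measure -/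

instance SpectralMeasure.isFiniteMeasure_scalarMeasure (E : SpectralMeasure H) (x : H) :
    IsFiniteMeasure (E.scalarMeasure x) :=
  ⟨by rw [E.scalarMeasure_apply x MeasurableSet.univ]; exact ENNReal.ofReal_lt_top⟩

theorem integrable_of_continuous_circle {F : Type*} [NormedAddCommGroup F]
    (μ : Measure Circle) [IsFiniteMeasure μ] {f : Circle → F} (hf : Continuous f) :
    Integrable f μ :=
  hf.integrable_of_hasCompactSupport (HasCompactSupport.of_compactSpace _)

theorem one_sub_mul_circle_ne_zero {a : ℂ} (ha : ‖a‖ < 1) (z : Circle) : 1 - a * z ≠ 0 := by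
  intro h
  have h1 : ‖a * z‖ = 1 := by rw [← sub_eq_zero.1 h, norm_one]
  rw [norm_mul, Circle.norm_coe, mul_one] at h1
  exact ha.ne h1

theorem SpectralMeasure.IsSpectralMeasureOf.inner_tsum_pow {E : SpectralMeasure H}
    {U : unitary (H →L[ℂ] H)} (hE : E.IsSpectralMeasureOf U) {a : ℂ} (ha : ‖a‖ < 1) (y : H) :
    inner ℂ y ((∑' n, (a • (U : H →L[ℂ] H)) ^ n) y) =
      ∫ z : Circle, (1 - a * z)⁻¹ ∂(E.scalarMeasure y) := by
  have h1 : HasSum (fun n => inner ℂ y (((a • (U : H →L[ℂ] H)) ^ n) y))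
      (inner ℂ y ((∑' n, (a • (U : H →L[ℂ] H)) ^ n) y)) :=
    ((summable_geometric_of_norm_lt_one
      (norm_smul_lt_one ha (norm_unitary_coe_le_one U))).hasSum.mapL
        (ContinuousLinearMap.apply ℂ H y)).mapL (innerSL ℂ y)
  have h2 : ∀ n : ℕ, inner ℂ y (((a • (U : H →L[ℂ] H)) ^ n) y) =
      ∫ z : Circle, (a * z) ^ n ∂(E.scalarMeasure y) := by
    intro n
    have h3 := hE n y
    rw [zpow_natCast, SubmonoidClass.coe_pow] at h3
    rw [smul_pow, smul_apply, inner_smul_right, h3, ← integral_const_mul]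
    congr 1
    ext z
    rw [zpow_natCast, Circle.coe_pow, mul_pow]
  have h4 : HasSum (fun n : ℕ => ∫ z : Circle, (a * z) ^ n ∂(E.scalarMeasure y))
      (∫ z : Circle, ∑' n : ℕ, (a * z) ^ n ∂(E.scalarMeasure y)) := by
    refine hasSum_integral_of_summable_integral_norm (fun n => ?_) ?_
    · exact integrable_of_continuous_circle _ (by fun_prop)
    · simp only [norm_pow, norm_mul, Circle.norm_coe, mul_one, integral_const, smul_eq_mul]
      exact (summable_geometric_of_lt_one (norm_nonneg _) ha).mul_left _
  simp only [h2] at h1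
  rw [h1.unique h4]
  congr 1
  ext z
  refine tsum_geometric_of_norm_lt_one ?_
  rwa [norm_mul, Circle.norm_coe, mul_one]

/-- The identity for isometries at `k = (1 - aU)⁻¹ y` expresses `(1 - ‖a‖²) ‖k‖²` through `⟪y, k⟫`,
which is already known as an integral. The real part of the integrand is the Poisson kernel, which
carries the same factor `1 - ‖a‖²`; it cancels. -/
theorem SpectralMeasure.IsSpectralMeasureOf.norm_sq_resolvent {E : SpectralMeasure H}
    {U : unitary (H →L[ℂ] H)} (hE : E.IsSpectralMeasureOf U) {a : ℂ} (ha : ‖a‖ < 1) (y : H) :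
    ‖(∑' n, (a • (U : H →L[ℂ] H)) ^ n) y‖ ^ 2 =
      ∫ z : Circle, (‖1 - a * z‖ ^ 2)⁻¹ ∂(E.scalarMeasure y) := by
  set V := a • (U : H →L[ℂ] H) with hV
  have hV1 : ‖V‖ < 1 := norm_smul_lt_one ha (norm_unitary_coe_le_one U)
  set k := (∑' n, V ^ n) y with hk
  have hkV : k - V k = y := tsum_pow_sub_apply hV1 y
  have ha2 : 0 < 1 - ‖a‖ ^ 2 := by
    have := pow_lt_one₀ (norm_nonneg a) ha two_ne_zero
    linarith
  have hcont : Continuous fun z : Circle => (1 - a * z)⁻¹ :=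
    (by fun_prop : Continuous fun z : Circle => 1 - a * z).inv₀ (one_sub_mul_circle_ne_zero ha)
  have h1 := re_inner_herglotz_unitary U ha k
  rw [← hV, hkV, two_mul, sub_apply, add_apply, ← hk, one_apply_eq_self, inner_sub_right,
    inner_add_right, hk, hV, hE.inner_tsum_pow ha, inner_self_eq_norm_sq_to_K] at h1
  have h2 : ((‖y‖ : ℂ)) ^ 2 = ∫ _ : Circle, (1 : ℂ) ∂(E.scalarMeasure y) := by
    have := hE 0 y
    simpa using this
  have h3 : ∫ z : Circle, (2 * (1 - a * z)⁻¹ - 1 : ℂ).re ∂(E.scalarMeasure y) =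
      (1 - ‖a‖ ^ 2) * ‖k‖ ^ 2 := by
    rw [hk, hV, ← h1]
    have hi : Integrable (fun z : Circle => (1 - a * z)⁻¹) (E.scalarMeasure y) :=
      integrable_of_continuous_circle _ hcont
    have h4 := integral_re (((hi.const_mul 2).sub (integrable_const 1)))
    simp only [Pi.sub_apply, RCLike.re_to_complex] at h4
    rw [h4, integral_sub (hi.const_mul 2) (integrable_const 1), integral_const_mul, ← h2, two_mul]
    rfl
  have h5 : ∀ z : Circle, (2 * (1 - a * z)⁻¹ - 1 : ℂ).re =
      (1 - ‖a‖ ^ 2) * (‖1 - a * z‖ ^ 2)⁻¹ := by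
    intro z
    rw [Complex.re_two_mul_inv_one_sub_sub_one
      (sub_ne_zero.1 (one_sub_mul_circle_ne_zero ha z)).symm, norm_mul, Circle.norm_coe, mul_one,
      div_eq_mul_inv]
  simp only [h5] at h3
  rw [integral_const_mul] at h3
  exact (mul_left_cancel₀ ha2.ne' h3).symm

end Hilbert
-- From the resolvent bound to a linear bound on arcs
-- Lebesgue outer measure is the largest outer measure dominated by the length function on sets, so
-- comparison on half-open intervals suffices.
theorem Real.measure_le_volume_of_Ioc_le {ν : Measure ℝ}
    (h : ∀ a b : ℝ, ν (Set.Ioc a b) ≤ ENNReal.ofReal (b - a)) : ν ≤ volume := by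
  rw [Real.volume_eq_stieltjes_id]
  refine Measure.le_iff'.2 fun s => ?_
  have h1 : ν.toOuterMeasure ≤ StieltjesFunction.id.outer := by
    refine OuterMeasure.le_ofFunction.2 fun s => ?_
    rw [StieltjesFunction.length_eq]
    refine le_iInf fun a => le_iInf fun b => le_iInf fun hs => ?_
    refine le_trans (measure_mono ?_) (h a b)
    -- The covering in `length_eq` leaves out least elements (`botSet`), of which `ℝ` has none.
    exact fun x hx => hs ⟨hx, notMem_botSet_of_lt (sub_one_lt x)⟩
  rw [StieltjesFunction.measure]
  exact h1 s

/-- For `z = t e^{is}` the quantity is `ε - (1 - ε)(e^{is} - 1)`, and `|e^{is} - 1| ≤ |s| < ε`. -/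
theorem Circle.norm_one_sub_le_of_mem_arc {t z : Circle} {ε : ℝ} (hε : 0 ≤ ε) (hε1 : ε ≤ 1)
    (hz : z ∈ Circle.arc t ε) :
    ‖1 - ((1 - ε : ℝ) : ℂ) * ((t⁻¹ : Circle) : ℂ) * z‖ ≤ 2 * ε := by
  obtain ⟨s, hs, rfl⟩ := hz
  have h1 : ‖Complex.exp (Complex.I * s) - 1‖ ≤ ε :=
    Real.norm_exp_I_mul_ofReal_sub_one_le.trans (abs_lt.2 hs).le
  have h2 : 1 - ((1 - ε : ℝ) : ℂ) * ((t⁻¹ : Circle) : ℂ) * ((t * Circle.exp s : Circle) : ℂ) =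
      (ε : ℂ) - ((1 - ε : ℝ) : ℂ) * (Complex.exp (Complex.I * s) - 1) := by
    have h3 : ((t⁻¹ : Circle) : ℂ) * (t : ℂ) = 1 := by
      rw [← Circle.coe_mul, inv_mul_cancel, Circle.coe_one]
    rw [Circle.coe_mul, Circle.coe_exp, mul_comm Complex.I]
    rw [Complex.ofReal_sub, Complex.ofReal_one]
    linear_combination (-(1 - (ε : ℂ)) * Complex.exp (s * Complex.I)) * h3
  rw [h2]
  refine (norm_sub_le _ _).trans ?_
  rw [norm_mul, Complex.norm_real, Complex.norm_real, Real.norm_of_nonneg hε,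
    Real.norm_of_nonneg (by linarith)]
  nlinarith [norm_nonneg (Complex.exp (Complex.I * s) - 1)]

section Hilbert

variable {H : Type*} [NormedAddCommGroup H] [InnerProductSpace ℂ H] [CompleteSpace H]

/-- Markov's inequality for `‖1 - a z‖⁻²`, which is at least `(4 ε²)⁻¹` on the arc when `a = (1 - ε)
t⁻¹`. -/
theorem SpectralMeasure.IsSpectralMeasureOf.real_arc_le {E : SpectralMeasure H}
    {U : unitary (H →L[ℂ] H)} (hE : E.IsSpectralMeasureOf U) (y : H) (t : Circle) {ε : ℝ}
    (hε : 0 < ε) (hε1 : ε ≤ 1) :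
    (E.scalarMeasure y).real (Circle.arc t ε) ≤ 4 * ε ^ 2 *
      ‖(∑' n, ((((1 - ε : ℝ) : ℂ) * ((t⁻¹ : Circle) : ℂ)) • (U : H →L[ℂ] H)) ^ n) y‖ ^ 2 := by
  set a := ((1 - ε : ℝ) : ℂ) * ((t⁻¹ : Circle) : ℂ) with ha
  have ha1 : ‖a‖ < 1 := by
    rw [ha, norm_mul, Circle.norm_coe, mul_one, Complex.norm_real,
      Real.norm_of_nonneg (by linarith)]
    linarith
  have hcont : Continuous fun z : Circle => (‖1 - a * z‖ ^ 2)⁻¹ :=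
    (by fun_prop : Continuous fun z : Circle => ‖1 - a * z‖ ^ 2).inv₀ fun z =>
      pow_ne_zero _ (norm_ne_zero_iff.2 (one_sub_mul_circle_ne_zero ha1 z))
  have h0 : ∀ z : Circle, 0 ≤ (‖1 - a * z‖ ^ 2)⁻¹ := fun z => by positivity
  have h1 := mul_meas_ge_le_integral_of_nonneg (μ := E.scalarMeasure y)
    (Eventually.of_forall h0)
    (integrable_of_continuous_circle _ hcont) (4 * ε ^ 2)⁻¹
  rw [← hE.norm_sq_resolvent ha1] at h1
  have h2 : Circle.arc t ε ⊆ {z : Circle | (4 * ε ^ 2)⁻¹ ≤ (‖1 - a * z‖ ^ 2)⁻¹} := by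
    intro z hz
    have h3 := Circle.norm_one_sub_le_of_mem_arc hε.le hε1 hz
    have h4 : 0 < ‖1 - a * z‖ := norm_pos_iff.2 (one_sub_mul_circle_ne_zero ha1 z)
    rw [Set.mem_ofPred_eq]
    refine inv_anti₀ (by positivity) ?_
    calc ‖1 - a * z‖ ^ 2 ≤ (2 * ε) ^ 2 := by gcongr
      _ = 4 * ε ^ 2 := by ring
  refine (measureReal_mono h2).trans ?_
  rwa [inv_mul_le_iff₀ (by positivity)] at h1

theorem HarnackDominated.exists_scalarMeasure_arc_le {U : unitary (H →L[ℂ] H)} {T : H →L[ℂ] H}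
    (hT : ‖T‖ ≤ 1) (hUT : HarnackDominated (U : H →L[ℂ] H) T) {E : SpectralMeasure H}
    (hE : E.IsSpectralMeasureOf U) (h : H) :
    ∃ K : ℝ, 0 < K ∧ ∀ (t : Circle) (ε : ℝ), 0 < ε →
      E.scalarMeasure ((U : H →L[ℂ] H) h - T h) (Circle.arc t ε) ≤ ENNReal.ofReal (K * ε) := by
  obtain ⟨c, hc, hle⟩ := hUT.exists_norm_sq_resolvent_le hT
  set y := (U : H →L[ℂ] H) h - T h with hy
  set μ := E.scalarMeasure y with hμ
  -- The first term serves `ε ≤ 1/2`; the second serves `ε > 1/2`, where the total mass is at most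
  -- `2 ε` times itself; the `1` makes `K` positive.
  refine ⟨32 * (1 + c) * ‖h‖ ^ 2 + 2 * μ.real Set.univ + 1, by positivity, fun t ε hε => ?_⟩
  rw [← ofReal_measureReal]
  refine ENNReal.ofReal_le_ofReal ?_
  have hh : 0 ≤ 32 * (1 + c) * ‖h‖ ^ 2 := by positivity
  have hu : 0 ≤ μ.real Set.univ := measureReal_nonneg
  rcases le_or_gt ε (1 / 2) with hε2 | hε2
  · have h1 := hE.real_arc_le y t hε (by linarith)
    set a := ((1 - ε : ℝ) : ℂ) * ((t⁻¹ : Circle) : ℂ) with ha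
    have hna : ‖a‖ = 1 - ε := by
      rw [ha, norm_mul, Circle.norm_coe, mul_one, Complex.norm_real,
        Real.norm_of_nonneg (by linarith)]
    have h2 := hle a (by linarith) h
    set k := (∑' n, (a • (U : H →L[ℂ] H)) ^ n) y with hk
    set g := h + a • k with hg
    -- Here `1 - ‖a‖² = ε (2 - ε) ≥ ε`.
    have h3 : ε * ‖g‖ ^ 2 ≤ c * ‖h‖ ^ 2 := by
      refine le_trans (mul_le_mul_of_nonneg_right ?_ (sq_nonneg _)) h2
      rw [hna]
      nlinarith
    have h4 : (1 - ε) * ‖k‖ ≤ ‖g‖ + ‖h‖ := by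
      rw [← hna, ← norm_smul]
      have : a • k = g - h := by rw [hg]; abel
      rw [this]
      exact norm_sub_le _ _
    have h5 : ‖k‖ ≤ 2 * (‖g‖ + ‖h‖) := by nlinarith [norm_nonneg k]
    have h6 : ‖k‖ ^ 2 ≤ 8 * (‖g‖ ^ 2 + ‖h‖ ^ 2) := by
      have := pow_le_pow_left₀ (norm_nonneg k) h5 2
      nlinarith [sq_nonneg (‖g‖ - ‖h‖)]
    have h7 : ε * ‖k‖ ^ 2 ≤ 8 * (1 + c) * ‖h‖ ^ 2 := by
      have h8 := mul_le_mul_of_nonneg_left h6 hε.le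
      have h9 : ε * ‖h‖ ^ 2 ≤ ‖h‖ ^ 2 :=
        mul_le_of_le_one_left (sq_nonneg _) (by linarith)
      linarith
    calc μ.real (Circle.arc t ε) ≤ 4 * ε * (ε * ‖k‖ ^ 2) := h1.trans_eq (by ring)
      _ ≤ 4 * ε * (8 * (1 + c) * ‖h‖ ^ 2) := by gcongr
      _ = 32 * (1 + c) * ‖h‖ ^ 2 * ε := by ring
      _ ≤ _ := by gcongr; linarith
  · refine (measureReal_mono (Set.subset_univ _)).trans ?_
    nlinarith

end Hilbert

/-! ### Consequences of the linear bound: density and absolute continuity -/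

theorem Circle.upperDensity_lt_top {μ : Measure Circle} {t : Circle} {K : ℝ}
    (h : ∀ ε : ℝ, 0 < ε → μ (Circle.arc t ε) ≤ ENNReal.ofReal (K * ε)) :
    Circle.upperDensity μ t < ⊤ := by
  refine lt_of_le_of_lt ?_ (ENNReal.ofReal_lt_top (r := K / 2))
  refine limsup_le_of_le (by isBoundedDefault) ?_
  filter_upwards [self_mem_nhdsWithin] with ε hε
  have hε : 0 < ε := hε
  refine ENNReal.div_le_of_le_mul ((h ε hε).trans_eq ?_)
  rw [← ENNReal.ofReal_mul' (by positivity)]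
  congr 1
  ring

/-- Unrolling the circle by `arg` turns the bound on arcs into a bound on intervals, so the image of
`μ` is at most `K` times Lebesgue measure on the line. Uniformity in `t` replaces any
differentiation theorem. -/
theorem Circle.absolutelyContinuous_lebesgue {μ : Measure Circle} {K : ℝ} (hK : 0 < K)
    (h : ∀ (t : Circle) (ε : ℝ), 0 < ε → μ (Circle.arc t ε) ≤ ENNReal.ofReal (K * ε)) :
    μ ≪ Circle.lebesgue := by
  have harg : Measurable fun z : Circle => Complex.arg z :=
    Complex.measurable_arg.comp
      (by fun_prop : Continuous fun z : Circle => (z : ℂ)).measurable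
  set ν := μ.map fun z : Circle => Complex.arg z with hν
  have hI : ∀ a b : ℝ, ν (Set.Ioc a b) ≤ ENNReal.ofReal K * ENNReal.ofReal (b - a) := by
    intro a b
    rcases le_or_gt b a with hab | hab
    · simp [Set.Ioc_eq_empty_of_le hab]
    rw [hν, Measure.map_apply harg measurableSet_Ioc, ← ENNReal.ofReal_mul hK.le]
    -- An arc about the midpoint of half-length `b - a`, twice what is needed, so that the endpoint
    -- `b` lies in the open arc.
    refine (measure_mono ?_).trans (h (Circle.exp ((a + b) / 2)) (b - a) (by linarith))
    intro z hz
    refine ⟨Complex.arg z - (a + b) / 2, ⟨by linarith [hz.1], by linarith [hz.2]⟩, ?_⟩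
    simp only []
    rw [← Circle.exp_add, add_sub_cancel, Circle.exp_arg]
  have hle : (ENNReal.ofReal K)⁻¹ • ν ≤ volume := by
    refine Real.measure_le_volume_of_Ioc_le fun a b => ?_
    rw [Measure.smul_apply, smul_eq_mul, ENNReal.inv_mul_le_iff (by simpa using hK)
      ENNReal.ofReal_ne_top]
    exact hI a b
  refine Measure.AbsolutelyContinuous.mk fun s hs hs0 => ?_
  have hexp : Measurable fun x : ℝ => Circle.exp x := Circle.exp.continuous.measurable
  rw [Circle.lebesgue, Measure.map_apply hexp hs,
    Measure.restrict_apply (hexp hs)] at hs0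
  have hν0 : ν (Circle.exp ⁻¹' s ∩ Set.Ioc (-Real.pi) Real.pi) = 0 := by
    have h1 := hle (Circle.exp ⁻¹' s ∩ Set.Ioc (-Real.pi) Real.pi)
    rw [hs0, Measure.smul_apply, smul_eq_mul, nonpos_iff_eq_zero, mul_eq_zero] at h1
    exact h1.resolve_left (by simp)
  rw [hν, Measure.map_apply harg ((hexp hs).inter measurableSet_Ioc)] at hν0
  refine measure_mono_null (fun z hz => ?_) hν0
  refine ⟨?_, Complex.neg_pi_lt_arg _, Complex.arg_le_pi _⟩
  show Circle.exp (Complex.arg z) ∈ s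
  rwa [Circle.exp_arg]

section Hilbert

variable {H : Type*} [NormedAddCommGroup H] [InnerProductSpace ℂ H] [CompleteSpace H]

theorem SpectralMeasure.eq_zero_of_scalarMeasure_eq_zero (E : SpectralMeasure H) {x : H}
    (h : E.scalarMeasure x = 0) : x = 0 := by
  have h1 := E.scalarMeasure_apply x MeasurableSet.univ
  rw [h, E.proj_univ, one_apply_eq_self, inner_self_eq_norm_sq_to_K, Measure.coe_zero,
    Pi.zero_apply, eq_comm, ENNReal.ofReal_eq_zero] at h1
  have h2 : ‖x‖ ^ 2 ≤ 0 := by exact_mod_cast h1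
  simpa using le_antisymm h2 (sq_nonneg _)

end Hilbert

theorem mainTheorem4 {H : Type*} [NormedAddCommGroup H] [InnerProductSpace ℂ H] [CompleteSpace H]
    (U : unitary (H →L[ℂ] H)) :
    (∀ T : H →L[ℂ] H, ‖T‖ ≤ 1 → HarnackDominated (U : H →L[ℂ] H) T →
      ∀ h y : H, y = (U : H →L[ℂ] H) h - T h → y ≠ 0 →
        ∀ t : Circle, Circle.upperDensity ((spectralMeasure U).scalarMeasure y) t < ⊤) ∧
    (IsSingularUnitary U → IsHarnackMaximal (U : H →L[ℂ] H)) := by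
  constructor
  · rintro T hT hUT h _ rfl - t
    obtain ⟨K, -, hK⟩ := hUT.exists_scalarMeasure_arc_le hT (spectralMeasure_spec U) h
    exact Circle.upperDensity_lt_top (hK t)
  · refine fun hU => ⟨norm_unitary_coe_le_one U, fun T hT hUT => ?_⟩
    ext h
    obtain ⟨K, hK0, hK⟩ := hUT.exists_scalarMeasure_arc_le hT (spectralMeasure_spec U) h
    -- The measure of `(U - T) h` is both absolutely continuous and singular, hence zero; its total
    -- mass is `‖(U - T) h‖²`.
    have h0 := Measure.eq_zero_of_absolutelyContinuous_of_mutuallySingular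
      (Circle.absolutelyContinuous_lebesgue hK0 hK) (hU _)
    exact (sub_eq_zero.1 ((spectralMeasure U).eq_zero_of_scalarMeasure_eq_zero h0)).symm
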